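/- Let $N\ge 1$ be an integer, let $1<p<\infty$, and let $f\in L^p(\mathbb{R}^N)$ be real-valued. For $0<s<1$ put $$[f]_{\dot W^{s,p}(\mathbb{R}^N)}=\Big(\int_{\mathbb{R}^N}\int_{\mathbb{R}^N}\frac{|f(x)-f(y)|^p}{|x-y|^{N+sp}}\,dx\,dy\Big)^{1/p}\in[0,\infty],$$ let $\|\nabla f\|_{L^p(\mathbb{R}^N)}\in[0,\infty]$ be the $L^p$ norm of the Euclidean length of the distributional gradient of $f$ (equal to $\infty$ if that gradient is not an $L^p$ function), let $H^{1,p}(\mathbb{R}^N)=\{f\in L^p(\mathbb{R}^N):\nabla f\in L^p(\mathbb{R}^N)\}$, and let $k(p,N)=\int_{\mathbb{S}^{N-1}}|e\cdot\omega|^p\,d\omega$, where $e$ is any unit vector in $\mathbb{R}^N$ and $d\omega$ is the surface measure on the unit sphere (counting measure if $N=1$). Then $$\|\nabla f\|_{L^p(\mathbb{R}^N)}=\Big(\frac{p}{k(p,N)}\Big)^{1/p}\lim_{s\to1^-}(1-s)^{1/p}[f]_{\dot W^{s,p}(\mathbb{R}^N)}$$ in the following sense: the left-hand side is finite if and only if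 the limit on the right-hand side exists and is finite, and in that case the two sides are equal. Moreover, if $\liminf_{s\to1^-}(1-s)^{1/p}[f]_{\dot W^{s,p}(\mathbb{R}^N)}<\infty$, then $f\in H^{1,p}(\mathbb{R}^N)$. -/

import Mathlib

open MeasureTheory Filter Topology
open scoped ENNReal NNReal

noncomputable section

namespace BBM

/-- The Euclidean space `ℝ^N`. -/
abbrev Eucl (N : ℕ) : Type := EuclideanSpace ℝ (Fin N)

/-- The Gagliardo seminorm
`[f]_{Ẇ^{s,p}(ℝ^N)} = (∫ ∫ |f(x) - f(y)|^p / |x - y|^(N + s p) dx dy)^(1/p)`,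
with values in `[0, ∞]`. (The integrand is `0 / 0 = 0` on the null set `x = y`.) -/
def gagliardo {N : ℕ} (s p : ℝ) (f : Eucl N → ℝ) : ℝ≥0∞ :=
  (∫⁻ y : Eucl N, ∫⁻ x : Eucl N,
    ‖f x - f y‖ₑ ^ p / ‖x - y‖ₑ ^ ((N : ℝ) + s * p)) ^ (1 / p)

/-- `g` is the weak (distributional) gradient of `f` on `ℝ^N`: both are locally integrable and
`∫ f ∂ᵢφ = - ∫ gᵢ φ` for every `i` and every test function `φ ∈ C_c^∞(ℝ^N)`. -/
def HasWeakGradient {N : ℕ} (f : Eucl N → ℝ) (g : Eucl N → Eucl N) : Prop :=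
  LocallyIntegrable f volume ∧ LocallyIntegrable g volume ∧
    ∀ φ : Eucl N → ℝ, ContDiff ℝ ((⊤ : ℕ∞) : WithTop ℕ∞) φ → HasCompactSupport φ → ∀ i : Fin N,
      ∫ x, f x * fderiv ℝ φ x (EuclideanSpace.single i 1) = -∫ x, g x i * φ x

/-- `‖∇f‖_{L^p(ℝ^N)} ∈ [0, ∞]`: the `L^p` norm of the Euclidean length of the weak gradient,
and `∞` if `f` has no weak gradient. (A weak gradient is unique up to null sets, so the infimum
is over at most one value.) -/
def gradLpNorm {N : ℕ} (p : ℝ) (f : Eucl N → ℝ) : ℝ≥0∞ :=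
  ⨅ (g : Eucl N → Eucl N) (_ : HasWeakGradient f g), eLpNorm g (ENNReal.ofReal p) volume

/-- Membership in the Sobolev space `H^{1,p}(ℝ^N) = {f ∈ L^p : ∇f ∈ L^p}`. -/
def MemH1p {N : ℕ} (p : ℝ) (f : Eucl N → ℝ) : Prop :=
  MemLp f (ENNReal.ofReal p) volume ∧
    ∃ g : Eucl N → Eucl N, HasWeakGradient f g ∧ MemLp g (ENNReal.ofReal p) volume

/-- `∫_{S^{N-1}} |e · ω|^p dω`, with respect to the surface measure on the unit sphere. -/
def sphereConst {N : ℕ} (p : ℝ) (e : Eucl N) : ℝ :=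
  ∫ w : Metric.sphere (0 : Eucl N) 1, |inner ℝ e (w : Eucl N)| ^ p
    ∂((volume : Measure (Eucl N)).toSphere)

/-- The rescaled seminorm `(1 - s)^(1/p) [f]_{Ẇ^{s,p}(ℝ^N)}`. -/
def scaledGagliardo {N : ℕ} (p : ℝ) (f : Eucl N → ℝ) (s : ℝ) : ℝ≥0∞ :=
  ENNReal.ofReal (1 - s) ^ (1 / p) * gagliardo s p f

end BBM

end

/-! In polar coordinates around the diagonal, `(1 - s) * gagliardoEnergy s p f` becomes `(1 - s) ∫
r^(-(1 + s p)) ψ(r) dr`, where `ψ(r)` is the sphere integral of `‖f(· + rω) - f‖_p^p`. Against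
`r^p`, the weight `(1 - s) r^(p(1-s)-1)` has mass tending to `1/p` on every `(0, δ]` and
concentrates at `0` as `s → 1`. The limit therefore reads off the behaviour of `ψ(r) / r^p` at `0`,
which should be `k(p,N) ∫ |∇f|^p`.

Upper bound (`limsup_radial_le`, `sphericalShiftEnergy_le`): the mean value inequality in `L^p`
gives `ψ(r) ≤ r^p k ∫ |∇f|^p` for all `r`, while `f ∈ L^p` bounds `ψ` for large `r`, where the
factor `1 - s` kills the contribution.

Lower bound (`le_liminf_gagliardoEnergy`): for `C^1` functions this is Fatou applied to difference
quotients. Mollification does not increase the energy (`gagliardoEnergy_mollify_le`), so the `L^p`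
norms of the gradients of all mollifications of `f` are controlled by the lower limit for `f`
itself, with no regularity assumed.

Hence a finite lower limit gives gradients bounded in `L^p`. A limit tested against `C_c` is a weak
gradient (`exists_hasWeakGradient`); here `p > 1` matters, because the conjugate exponent is finite
and the limiting functional is then given by a function rather than a singular measure. -/

open scoped Convolution CompactlySupported

namespace BBM

variable {N : ℕ}

/-! ### `L^p` norms and Jensen's inequality -/

section Lp

variable {α F : Type*} [MeasurableSpace α] {μ : Measure α} [NormedAddCommGroup F]

theorem eLpNorm_ofReal_rpow {p : ℝ} (hp : 0 < p) (u : α → F) :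
    eLpNorm u (ENNReal.ofReal p) μ ^ p = ∫⁻ x, ‖u x‖ₑ ^ p ∂μ := by
  rw [eLpNorm_eq_lintegral_rpow_enorm_toReal (by simpa using hp) ENNReal.ofReal_ne_top,
    ENNReal.toReal_ofReal hp.le, ← ENNReal.rpow_mul, one_div_mul_cancel hp.ne', ENNReal.rpow_one]

theorem eLpNorm_ofReal_eq {p : ℝ} (hp : 0 < p) (u : α → F) :
    eLpNorm u (ENNReal.ofReal p) μ = (∫⁻ x, ‖u x‖ₑ ^ p ∂μ) ^ (1 / p) := by
  rw [eLpNorm_eq_lintegral_rpow_enorm_toReal (by simpa using hp) ENNReal.ofReal_ne_top,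
    ENNReal.toReal_ofReal hp.le]

/-- Jensen's inequality for the `p`-th power of the norm of a mean. -/
theorem enorm_integral_rpow_le [NormedSpace ℝ F] [IsProbabilityMeasure μ] {p : ℝ} (hp : 1 ≤ p)
    {u : α → F} (hu : AEStronglyMeasurable u μ) :
    ‖∫ x, u x ∂μ‖ₑ ^ p ≤ ∫⁻ x, ‖u x‖ₑ ^ p ∂μ := by
  rw [← eLpNorm_ofReal_rpow (by linarith) u]
  refine ENNReal.rpow_le_rpow ?_ (by linarith)
  calc ‖∫ x, u x ∂μ‖ₑ ≤ eLpNorm u 1 μ := by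
        rw [eLpNorm_one_eq_lintegral_enorm]
        exact enorm_integral_le_lintegral_enorm u
    _ ≤ _ := eLpNorm_le_eLpNorm_of_exponent_le (by simpa using hp) hu

end Lp

/-! ### Polar coordinates -/

section Polar

/-- The surface measure on the unit sphere of `ℝ^N`. -/
noncomputable abbrev surfaceMeasure (N : ℕ) : Measure (Metric.sphere (0 : Eucl N) 1) :=
  (volume : Measure (Eucl N)).toSphere

/-- Integration in polar coordinates. -/
theorem lintegral_polar (hN : 1 ≤ N) {G : Eucl N → ℝ≥0∞} (hG : Measurable G) :
    ∫⁻ x, G x = ∫⁻ w, (∫⁻ r in Set.Ioi (0 : ℝ),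
      ENNReal.ofReal (r ^ (N - 1)) * G (r • (w : Eucl N))) ∂surfaceMeasure N := by
  have : Nonempty (Fin N) := ⟨⟨0, hN⟩⟩
  have hmp := (volume : Measure (Eucl N)).measurePreserving_homeomorphUnitSphereProd
  have hdim : Module.finrank ℝ (Eucl N) = N := by simp
  rw [hdim] at hmp
  have hG2 : Measurable fun z : Metric.sphere (0 : Eucl N) 1 × Set.Ioi (0 : ℝ) ↦
      G ((z.2 : ℝ) • (z.1 : Eucl N)) := by fun_prop
  -- For `N ≥ 1` the origin is a null set and may be removed.
  calc ∫⁻ x, G x = ∫⁻ x : ({0}ᶜ : Set (Eucl N)), G x ∂(volume.comap Subtype.val) := by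
        rw [lintegral_subtype_comap (measurableSet_singleton _).compl, restrict_compl_singleton]
    _ = ∫⁻ z, G ((z.2 : ℝ) • (z.1 : Eucl N))
          ∂((surfaceMeasure N).prod (Measure.volumeIoiPow (N - 1))) := by
        rw [← hmp.lintegral_comp hG2]
        refine lintegral_congr fun x ↦ ?_
        have hx : ‖(x : Eucl N)‖ ≠ 0 := norm_ne_zero_iff.2 x.2
        congr 1
        simp [smul_smul, hx]
    _ = _ := by
        rw [lintegral_prod _ hG2.aemeasurable]
        refine lintegral_congr fun w ↦ ?_
        rw [Measure.volumeIoiPow, lintegral_withDensity_eq_lintegral_mul _ (by fun_prop)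
          (by fun_prop)]
        simp only [Pi.mul_apply]
        exact lintegral_subtype_comap measurableSet_Ioi
          (fun r : ℝ ↦ ENNReal.ofReal (r ^ (N - 1)) * G (r • (w : Eucl N)))

end Polar

/-! ### Moments of linear forms on the sphere -/

section Sphere

/-- The measure-theoretic version of `∫_{S^{N-1}} |⟨v, ω⟩|^p dω`. -/
noncomputable def sphereMoment (p : ℝ) (v : Eucl N) : ℝ≥0∞ :=
  ∫⁻ w, ‖inner ℝ v (w : Eucl N)‖ₑ ^ p ∂surfaceMeasure N

/-- Homogeneity of degree `p` splits off a radial factor. Rotational symmetry of `sphereMoment` can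
then be deduced from the invariance of Lebesgue measure on the ball. -/
theorem lintegral_ball_inner_rpow (hN : 1 ≤ N) {p : ℝ} (hp : 0 < p) (v : Eucl N) :
    ∫⁻ x in Metric.ball (0 : Eucl N) 1, ‖inner ℝ v x‖ₑ ^ p =
      sphereMoment p v * ∫⁻ r in Set.Ioo (0 : ℝ) 1, ENNReal.ofReal (r ^ ((N - 1 : ℕ) + p)) := by
  rw [← lintegral_indicator Metric.isOpen_ball.measurableSet, lintegral_polar hN
    (Measurable.indicator (by fun_prop) Metric.isOpen_ball.measurableSet), sphereMoment,
    ← lintegral_mul_const _ (by fun_prop)]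
  refine lintegral_congr fun w ↦ ?_
  rw [← lintegral_const_mul _ (by fun_prop), ← lintegral_indicator measurableSet_Ioi,
    ← lintegral_indicator measurableSet_Ioo]
  refine lintegral_congr fun r ↦ ?_
  by_cases hr : 0 < r
  swap
  · rw [Set.indicator_of_notMem (by simpa using hr),
      Set.indicator_of_notMem (fun h ↦ hr h.1)]
  rw [Set.indicator_of_mem (Set.mem_Ioi.2 hr)]
  have hw : ‖(w : Eucl N)‖ = 1 := by simp
  have hn : ‖r • (w : Eucl N)‖ = r := by rw [norm_smul, hw, mul_one, Real.norm_of_nonneg hr.le]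
  by_cases hr1 : r < 1
  · have m1 : r • (w : Eucl N) ∈ Metric.ball (0 : Eucl N) 1 := by
      rwa [mem_ball_zero_iff, hn]
    rw [Set.indicator_of_mem m1, Set.indicator_of_mem (Set.mem_Ioo.2 ⟨hr, hr1⟩),
      inner_smul_right, enorm_mul, ENNReal.mul_rpow_of_nonneg _ _ hp.le, mul_left_comm,
      ← mul_assoc, mul_comm _ (ENNReal.ofReal _), mul_comm _ (‖_‖ₑ ^ p)]
    congr 1
    rw [Real.rpow_add hr, Real.rpow_natCast, ENNReal.ofReal_mul (by positivity),
      ← ENNReal.ofReal_rpow_of_pos hr, Real.enorm_of_nonneg hr.le]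
  · rw [Set.indicator_of_notMem (by simpa [hn] using hr1),
      Set.indicator_of_notMem (fun h ↦ hr1 h.2), mul_zero]

theorem sphereMoment_eq_of_norm_eq (hN : 1 ≤ N) {p : ℝ} (hp : 0 < p) {v w : Eucl N}
    (h : ‖v‖ = ‖w‖) : sphereMoment p v = sphereMoment p w := by
  set c := ∫⁻ r in Set.Ioo (0 : ℝ) 1, ENNReal.ofReal (r ^ ((N - 1 : ℕ) + p)) with hc
  -- The radial factor is to be cancelled in `ℝ≥0∞`, so it must be neither `0` nor `⊤`.
  have hc0 : c ≠ 0 := by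
    rw [hc, ← pos_iff_ne_zero, setLIntegral_pos_iff (by fun_prop)]
    refine lt_of_lt_of_le ?_ (measure_mono (s := Set.Ioo (0 : ℝ) 1) ?_)
    · simp
    · intro r hr
      refine ⟨?_, hr⟩
      have : 0 < r ^ ((N - 1 : ℕ) + p) := Real.rpow_pos_of_pos hr.1 _
      simpa using this
  have hct : c ≠ ⊤ := by
    refine ne_top_of_le_ne_top (b := ∫⁻ r in Set.Ioo (0 : ℝ) 1, 1) (by simp) ?_
    refine setLIntegral_mono (by fun_prop) fun r hr ↦ ?_
    rw [ENNReal.ofReal_le_one]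
    exact Real.rpow_le_one hr.1.le hr.2.le (by positivity)
  have key : ∫⁻ x in Metric.ball (0 : Eucl N) 1, ‖inner ℝ v x‖ₑ ^ p =
      ∫⁻ x in Metric.ball (0 : Eucl N) 1, ‖inner ℝ w x‖ₑ ^ p := by
    -- For vectors of equal length, the reflection in the hyperplane orthogonal to `v - w` exchanges
    -- them.
    set R := (ℝ ∙ (v - w))ᗮ.reflection
    have hR : R v = w := Submodule.reflection_sub h
    have hmp : MeasurePreserving R volume volume := R.measurePreserving
    rw [← hR, ← hmp.setLIntegral_comp_preimage Metric.isOpen_ball.measurableSet (by fun_prop)]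
    have : R ⁻¹' Metric.ball (0 : Eucl N) 1 = Metric.ball (0 : Eucl N) 1 := by
      simp
    rw [this]
    refine lintegral_congr fun x ↦ ?_
    rw [← R.inner_map_map v (R x), Submodule.reflection_reflection]
  rw [lintegral_ball_inner_rpow hN hp, lintegral_ball_inner_rpow hN hp] at key
  exact (ENNReal.mul_left_inj hc0 hct).1 key

theorem continuous_inner_rpow {p : ℝ} (hp : 0 < p) (e : Eucl N) :
    Continuous fun w : Metric.sphere (0 : Eucl N) 1 ↦ |inner ℝ e (w : Eucl N)| ^ p :=
  Continuous.rpow_const (by fun_prop) fun _ ↦ .inr hp.le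

theorem sphereConst_pos {p : ℝ} (hp : 0 < p) {e : Eucl N} (he : ‖e‖ = 1) :
    0 < sphereConst p e := by
  refine (continuous_inner_rpow hp e).integral_pos_of_hasCompactSupport_nonneg_nonzero
    (HasCompactSupport.of_compactSpace _) (fun w ↦ by positivity)
    (x := ⟨e, by simpa using he⟩) ?_
  simp [he]

/-- By symmetry `v` may be replaced by `‖v‖ • e`, and the length comes out by homogeneity. This is
where the constant `k(p,N)` enters, independently of `e`. -/
theorem sphereMoment_eq (hN : 1 ≤ N) {p : ℝ} (hp : 0 < p) {e : Eucl N} (he : ‖e‖ = 1)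
    (v : Eucl N) : sphereMoment p v = ENNReal.ofReal (sphereConst p e) * ‖v‖ₑ ^ p := by
  have h1 : sphereMoment p v = sphereMoment p (‖v‖ • e) :=
    sphereMoment_eq_of_norm_eq hN hp (by simp [norm_smul, he])
  have h2 : sphereMoment p e = ENNReal.ofReal (sphereConst p e) := by
    rw [sphereConst, ofReal_integral_eq_lintegral_ofReal
      ((continuous_inner_rpow hp e).integrable_of_hasCompactSupport
        (HasCompactSupport.of_compactSpace _)) (.of_forall fun w ↦ by positivity), sphereMoment]
    refine lintegral_congr fun w ↦ ?_
    rw [← ENNReal.ofReal_rpow_of_nonneg (abs_nonneg _) hp.le, Real.enorm_eq_ofReal_abs]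
  rw [h1, ← h2, sphereMoment, sphereMoment, mul_comm, ← lintegral_const_mul _ (by fun_prop)]
  refine lintegral_congr fun w ↦ ?_
  rw [real_inner_smul_left, enorm_mul, ENNReal.mul_rpow_of_nonneg _ _ hp.le, enorm_norm]

end Sphere

/-! ### Concentration of the radial weights as `s → 1` -/

section Radial

theorem lintegral_Ioc_rpow {a δ : ℝ} (ha : -1 < a) (hδ : 0 ≤ δ) :
    ∫⁻ r in Set.Ioc 0 δ, ENNReal.ofReal (r ^ a) = ENNReal.ofReal (δ ^ (a + 1) / (a + 1)) := by
  have hi : IntervalIntegrable (fun r : ℝ ↦ r ^ a) volume 0 δ :=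
    intervalIntegral.intervalIntegrable_rpow' ha
  rw [← ofReal_integral_eq_lintegral_ofReal hi.1, ← intervalIntegral.integral_of_le hδ,
    integral_rpow (.inl ha), Real.zero_rpow (by linarith), sub_zero]
  filter_upwards [ae_restrict_mem measurableSet_Ioc] with r hr
  exact Real.rpow_nonneg hr.1.le _

theorem lintegral_Ioi_one_rpow {a : ℝ} (ha : a < -1) :
    ∫⁻ r in Set.Ioi (1 : ℝ), ENNReal.ofReal (r ^ a) = ENNReal.ofReal (-1 / (a + 1)) := by
  rw [← ofReal_integral_eq_lintegral_ofReal (integrableOn_Ioi_rpow_of_lt ha one_pos),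
    integral_Ioi_rpow_of_lt ha one_pos, Real.one_rpow]
  filter_upwards [ae_restrict_mem measurableSet_Ioi] with r hr
  exact Real.rpow_nonneg (zero_le_one.trans (le_of_lt hr)) _

/-- Only a short interval `(0, δ]` is kept. There `ψ(r) ≥ c' r^p`, and the weight gives `c'
δ^(p(1-s)) / p`, which tends to `c' / p` for fixed `δ`. -/
theorem le_liminf_radial {p : ℝ} (hp : 0 < p) {ψ : ℝ → ℝ≥0∞} {A : ℝ≥0∞}
    (hA : A ≤ liminf (fun r ↦ ψ r / ENNReal.ofReal (r ^ p)) (𝓝[>] 0)) :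
    A * ENNReal.ofReal (1 / p) ≤ liminf (fun s : ℝ ↦ ENNReal.ofReal (1 - s) *
      ∫⁻ r in Set.Ioi (0 : ℝ), ENNReal.ofReal (r ^ (-(1 + s * p))) * ψ r) (𝓝[<] 1) := by
  have hp' : ENNReal.ofReal (1 / p) ≠ 0 := by simpa using hp
  refine le_of_forall_lt_imp_le_of_dense fun c hc ↦ ?_
  rw [← ENNReal.div_lt_iff (.inl hp') (.inl ENNReal.ofReal_ne_top)] at hc
  -- `A` may be infinite; the comparison uses a finite `c' < A`.
  obtain ⟨c', hcc', hc'A⟩ := exists_between hc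
  have hc't : c' ≠ ⊤ := hc'A.ne_top
  rw [ENNReal.div_lt_iff (.inl hp') (.inl ENNReal.ofReal_ne_top)] at hcc'
  have hev := eventually_lt_of_lt_liminf (hc'A.trans_le hA)
  obtain ⟨δ, hδ0, hδ⟩ := (mem_nhdsGT_iff_exists_Ioc_subset).1 hev
  rw [Set.mem_Ioi] at hδ0
  have hlim : Tendsto (fun s : ℝ ↦ c' * ENNReal.ofReal (δ ^ (p * (1 - s)) / p)) (𝓝[<] 1)
      (𝓝 (c' * ENNReal.ofReal (1 / p))) := by
    refine ENNReal.Tendsto.const_mul (ENNReal.tendsto_ofReal ?_) (.inr hc't)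
    have : ContinuousAt (fun s : ℝ ↦ δ ^ (p * (1 - s)) / p) 1 := by
      refine ContinuousAt.div_const (ContinuousAt.rpow continuousAt_const (by fun_prop) ?_) _
      exact .inl hδ0.ne'
    simpa using this.tendsto.mono_left nhdsWithin_le_nhds
  refine le_liminf_of_le (by isBoundedDefault) ?_
  filter_upwards [hlim.eventually_const_lt hcc', Ioo_mem_nhdsLT (zero_lt_one (α := ℝ))]
    with s hs hs01
  refine hs.le.trans ?_
  have h1s : 0 < 1 - s := sub_pos.2 hs01.2
  calc c' * ENNReal.ofReal (δ ^ (p * (1 - s)) / p)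
      = ENNReal.ofReal (1 - s) * (c' *
          ∫⁻ r in Set.Ioc 0 δ, ENNReal.ofReal (r ^ (p * (1 - s) - 1))) := by
        rw [lintegral_Ioc_rpow (by nlinarith [mul_pos hp h1s]) hδ0.le, mul_left_comm,
          ← ENNReal.ofReal_mul h1s.le]
        congr 2
        have := hp.ne'
        have := h1s.ne'
        field_simp
        simp only [sub_add_cancel]
        ring
    _ = ENNReal.ofReal (1 - s) *
          ∫⁻ r in Set.Ioc 0 δ, c' * ENNReal.ofReal (r ^ (p * (1 - s) - 1)) := by
        rw [lintegral_const_mul' _ _ hc't]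
    _ ≤ ENNReal.ofReal (1 - s) *
          ∫⁻ r in Set.Ioc 0 δ, ENNReal.ofReal (r ^ (-(1 + s * p))) * ψ r := by
        gcongr ENNReal.ofReal (1 - s) * ?_
        refine setLIntegral_mono' measurableSet_Ioc fun r hr ↦ ?_
        have hr' : c' < ψ r / ENNReal.ofReal (r ^ p) := hδ hr
        have hrp : 0 < r ^ p := Real.rpow_pos_of_pos hr.1 _
        have h2 : c' * ENNReal.ofReal (r ^ p) ≤ ψ r :=
          ((ENNReal.lt_div_iff_mul_lt (.inl (by simpa using hrp))
            (.inl ENNReal.ofReal_ne_top)).1 hr').le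
        calc c' * ENNReal.ofReal (r ^ (p * (1 - s) - 1))
            = ENNReal.ofReal (r ^ (-(1 + s * p))) * (c' * ENNReal.ofReal (r ^ p)) := by
              rw [mul_left_comm, ← ENNReal.ofReal_mul (Real.rpow_nonneg hr.1.le _),
                ← Real.rpow_add hr.1]
              congr 3
              ring
          _ ≤ _ := by gcongr
    _ ≤ _ := by
        gcongr
        exact Set.Ioc_subset_Ioi_self

/-- Split at `r = 1`: the inner part contributes exactly `A / p` for every `s`, the tail at most `B
(1 - s) / (s p)`, which vanishes in the limit. -/
theorem limsup_radial_le {p : ℝ} (hp : 0 < p) {ψ : ℝ → ℝ≥0∞} {A B : ℝ≥0∞} (hAt : A ≠ ⊤)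
    (hBt : B ≠ ⊤) (hA : ∀ r, 0 < r → ψ r ≤ ENNReal.ofReal (r ^ p) * A)
    (hB : ∀ r, 1 < r → ψ r ≤ B) :
    limsup (fun s : ℝ ↦ ENNReal.ofReal (1 - s) *
      ∫⁻ r in Set.Ioi (0 : ℝ), ENNReal.ofReal (r ^ (-(1 + s * p))) * ψ r) (𝓝[<] 1) ≤
      A * ENNReal.ofReal (1 / p) := by
  have hlim : Tendsto (fun s : ℝ ↦ A * ENNReal.ofReal (1 / p) +
      B * ENNReal.ofReal ((1 - s) * (1 / (s * p)))) (𝓝[<] 1)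
      (𝓝 (A * ENNReal.ofReal (1 / p) + B * ENNReal.ofReal ((1 - 1) * (1 / (1 * p))))) := by
    refine tendsto_const_nhds.add (ENNReal.Tendsto.const_mul (ENNReal.tendsto_ofReal ?_)
      (.inr hBt))
    have : ContinuousAt (fun s : ℝ ↦ (1 - s) * (1 / (s * p))) 1 := by
      have : (1 : ℝ) * p ≠ 0 := by simpa using hp.ne'
      fun_prop (disch := assumption)
    exact this.tendsto.mono_left nhdsWithin_le_nhds
  have hlim' := hlim.limsup_eq
  simp only [sub_self, zero_mul, ENNReal.ofReal_zero, mul_zero, add_zero] at hlim'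
  rw [← hlim']
  refine limsup_le_limsup ?_
  filter_upwards [Ioo_mem_nhdsLT (zero_lt_one (α := ℝ))] with s hs
  have h1s : 0 < 1 - s := sub_pos.2 hs.2
  have hsp : 0 < s * p := mul_pos hs.1 hp
  have e1 : ∫⁻ r in Set.Ioc (0 : ℝ) 1, ENNReal.ofReal (r ^ (-(1 + s * p))) * ψ r ≤
      A * ENNReal.ofReal (1 / (p * (1 - s))) := by
    calc _ ≤ ∫⁻ r in Set.Ioc (0 : ℝ) 1, A * ENNReal.ofReal (r ^ (p * (1 - s) - 1)) := by
          refine setLIntegral_mono' measurableSet_Ioc fun r hr ↦ ?_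
          calc _ ≤ ENNReal.ofReal (r ^ (-(1 + s * p))) * (ENNReal.ofReal (r ^ p) * A) := by
                gcongr
                exact hA r hr.1
            _ = _ := by
                rw [← mul_assoc, mul_comm _ A, ← ENNReal.ofReal_mul (Real.rpow_nonneg hr.1.le _),
                  ← Real.rpow_add hr.1]
                congr 3
                ring
      _ = _ := by
          rw [lintegral_const_mul' _ _ hAt,
            lintegral_Ioc_rpow (by nlinarith [mul_pos hp h1s]) zero_le_one]
          simp
  have e2 : ∫⁻ r in Set.Ioi (1 : ℝ), ENNReal.ofReal (r ^ (-(1 + s * p))) * ψ r ≤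
      B * ENNReal.ofReal (1 / (s * p)) := by
    calc _ ≤ ∫⁻ r in Set.Ioi (1 : ℝ), B * ENNReal.ofReal (r ^ (-(1 + s * p))) := by
          refine setLIntegral_mono' measurableSet_Ioi fun r hr ↦ ?_
          rw [mul_comm]
          gcongr
          exact hB r hr
      _ = _ := by
          rw [lintegral_const_mul' _ _ hBt, lintegral_Ioi_one_rpow (by linarith)]
          congr 2
          rw [neg_add, neg_add_cancel_comm, neg_div_neg_eq]
  rw [← Set.Ioc_union_Ioi_eq_Ioi (zero_le_one (α := ℝ)), lintegral_union measurableSet_Ioi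
    (Set.Ioc_disjoint_Ioi le_rfl)]
  calc _ ≤ ENNReal.ofReal (1 - s) * (A * ENNReal.ofReal (1 / (p * (1 - s))) +
          B * ENNReal.ofReal (1 / (s * p))) := by gcongr
    _ = _ := by
        rw [mul_add, mul_left_comm, ← ENNReal.ofReal_mul h1s.le, mul_left_comm _ B,
          ← ENNReal.ofReal_mul h1s.le]
        congr 3
        have := hp.ne'
        have := h1s.ne'
        field_simp

end Radial

/-! ### The Gagliardo energy as a radial integral -/

section Energy

/-- The `p`-th power `∫ |f(y + h) - f(y)|^p dy` of the `L^p` modulus of continuity. -/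
noncomputable def shiftEnergy (p : ℝ) (f : Eucl N → ℝ) (h : Eucl N) : ℝ≥0∞ :=
  ∫⁻ y, ‖f (y + h) - f y‖ₑ ^ p

/-- The `p`-th power of the Gagliardo seminorm. -/
noncomputable def gagliardoEnergy (s p : ℝ) (f : Eucl N → ℝ) : ℝ≥0∞ :=
  ∫⁻ y : Eucl N, ∫⁻ x : Eucl N, ‖f x - f y‖ₑ ^ p / ‖x - y‖ₑ ^ ((N : ℝ) + s * p)

/-- The `L^p` modulus of continuity averaged over directions. -/
noncomputable def sphericalShiftEnergy (p : ℝ) (f : Eucl N → ℝ) (r : ℝ) : ℝ≥0∞ :=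
  ∫⁻ w, shiftEnergy p f (r • (w : Eucl N)) ∂surfaceMeasure N

theorem measurable_shiftEnergy (p : ℝ) {f : Eucl N → ℝ} (hf : Measurable f) :
    Measurable (shiftEnergy p f) := by
  unfold shiftEnergy
  exact Measurable.lintegral_prod_right'
    (f := fun z : Eucl N × Eucl N ↦ ‖f (z.2 + z.1) - f z.2‖ₑ ^ p) (by fun_prop)

theorem gagliardoEnergy_eq_lintegral_shiftEnergy (s p : ℝ) {f : Eucl N → ℝ} (hf : Measurable f) :
    gagliardoEnergy s p f = ∫⁻ h, shiftEnergy p f h * (‖h‖ₑ ^ ((N : ℝ) + s * p))⁻¹ := by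
  have h1 (y : Eucl N) : ∫⁻ x : Eucl N, ‖f x - f y‖ₑ ^ p / ‖x - y‖ₑ ^ ((N : ℝ) + s * p) =
      ∫⁻ h : Eucl N, ‖f (y + h) - f y‖ₑ ^ p * (‖h‖ₑ ^ ((N : ℝ) + s * p))⁻¹ := by
    rw [← lintegral_add_left_eq_self _ y]
    simp [div_eq_mul_inv]
  simp only [gagliardoEnergy, h1]
  rw [lintegral_lintegral_swap (by fun_prop)]
  refine lintegral_congr fun h ↦ ?_
  rw [lintegral_mul_const _ (by fun_prop), shiftEnergy]

/-- The Jacobian `r^(N-1)` against the kernel `r^(-(N + s p))` leaves `r^(-(1 + s p))`. -/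
theorem gagliardoEnergy_eq_radial (hN : 1 ≤ N) (s p : ℝ) {f : Eucl N → ℝ} (hf : Measurable f) :
    gagliardoEnergy s p f = ∫⁻ r in Set.Ioi (0 : ℝ),
      ENNReal.ofReal (r ^ (-(1 + s * p))) * sphericalShiftEnergy p f r := by
  have hm := measurable_shiftEnergy p hf
  rw [gagliardoEnergy_eq_lintegral_shiftEnergy s p hf, lintegral_polar hN (by fun_prop),
    lintegral_lintegral_swap (by fun_prop)]
  refine setLIntegral_congr_fun measurableSet_Ioi fun r (hr : 0 < r) ↦ ?_
  simp only [sphericalShiftEnergy]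
  rw [← lintegral_const_mul _ (by fun_prop)]
  refine lintegral_congr fun w ↦ ?_
  have hw : ‖(w : Eucl N)‖ = 1 := by simp
  have hn : ‖r • (w : Eucl N)‖ₑ = ENNReal.ofReal r := by
    rw [← ofReal_norm, norm_smul, hw, mul_one, Real.norm_of_nonneg hr.le]
  rw [hn, mul_left_comm, mul_comm]
  congr 1
  rw [ENNReal.ofReal_rpow_of_pos hr, ← ENNReal.ofReal_inv_of_pos (Real.rpow_pos_of_pos hr _),
    ← ENNReal.ofReal_mul (by positivity), ← Real.rpow_natCast, ← Real.rpow_neg hr.le,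
    ← Real.rpow_add hr]
  congr 2
  push_cast [hN]
  ring

end Energy

/-! ### Lower bound for `C^1` functions -/

section LowerBound

theorem tendsto_enorm_slope {p : ℝ} (hp : 0 < p) {u : Eucl N → ℝ} {v y : Eucl N}
    (hu : HasGradientAt u v y) (w : Eucl N) :
    Tendsto (fun r : ℝ ↦ ‖u (y + r • w) - u y‖ₑ ^ p / ENNReal.ofReal (r ^ p)) (𝓝[>] 0)
      (𝓝 (‖inner ℝ v w‖ₑ ^ p)) := by
  have h1 := (hu.hasFDerivAt.hasLineDerivAt w).tendsto_slope_zero_right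
  rw [InnerProductSpace.toDual_apply_apply] at h1
  have h2 := (ENNReal.continuous_rpow_const (y := p)).continuousAt.tendsto.comp
    (continuous_enorm.continuousAt.tendsto.comp h1)
  refine h2.congr' ?_
  filter_upwards [self_mem_nhdsWithin] with r hr
  rw [Set.mem_Ioi] at hr
  simp only [Function.comp_apply, smul_eq_mul]
  rw [enorm_mul, ENNReal.mul_rpow_of_nonneg _ _ hp.le, mul_comm, div_eq_mul_inv]
  congr 1
  rw [Real.enorm_of_nonneg (by positivity), ENNReal.ofReal_rpow_of_pos (by positivity),
    Real.inv_rpow hr.le, ENNReal.ofReal_inv_of_pos (by positivity)]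

/-- The lower bound for functions of class `C^1`. -/
theorem le_liminf_gagliardoEnergy (hN : 1 ≤ N) {p : ℝ} (hp : 0 < p) {e : Eucl N} (he : ‖e‖ = 1)
    {u : Eucl N → ℝ} {G : Eucl N → Eucl N} (hG : Continuous G)
    (hu : ∀ y, HasGradientAt u (G y) y) :
    ENNReal.ofReal (sphereConst p e) * (∫⁻ y, ‖G y‖ₑ ^ p) * ENNReal.ofReal (1 / p) ≤
      liminf (fun s ↦ ENNReal.ofReal (1 - s) * gagliardoEnergy s p u) (𝓝[<] 1) := by
  have huc : Continuous u := continuous_iff_continuousAt.2 fun y ↦ (hu y).continuousAt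
  simp only [gagliardoEnergy_eq_radial hN _ p huc.measurable]
  refine le_liminf_radial hp ?_
  have hf1 : Measurable fun z : Metric.sphere (0 : Eucl N) 1 × Eucl N ↦
      ‖inner ℝ (G z.2) (z.1 : Eucl N)‖ₑ ^ p := by
    have : Continuous fun z : Metric.sphere (0 : Eucl N) 1 × Eucl N ↦
      inner ℝ (G z.2) (z.1 : Eucl N) := by fun_prop
    exact this.measurable.enorm.pow_const p
  have hf2 (r : ℝ) : Measurable fun z : Metric.sphere (0 : Eucl N) 1 × Eucl N ↦
      ‖u (z.2 + r • (z.1 : Eucl N)) - u z.2‖ₑ ^ p / ENNReal.ofReal (r ^ p) := by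
    have : Continuous fun z : Metric.sphere (0 : Eucl N) 1 × Eucl N ↦
      u (z.2 + r • (z.1 : Eucl N)) - u z.2 := by fun_prop
    exact (this.measurable.enorm.pow_const p).div_const _
  calc ENNReal.ofReal (sphereConst p e) * ∫⁻ y, ‖G y‖ₑ ^ p
      = ∫⁻ y, sphereMoment p (G y) := by
        rw [← lintegral_const_mul _ (by fun_prop)]
        exact lintegral_congr fun y ↦ (sphereMoment_eq hN hp he _).symm
    -- Working on the product of sphere and space lets a single use of Fatou's lemma handle
    -- directions and base points together.
    _ = ∫⁻ z : Metric.sphere (0 : Eucl N) 1 × Eucl N, ‖inner ℝ (G z.2) (z.1 : Eucl N)‖ₑ ^ p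
          ∂((surfaceMeasure N).prod volume) := by
        rw [lintegral_prod_symm _ hf1.aemeasurable]
        rfl
    _ = ∫⁻ z : Metric.sphere (0 : Eucl N) 1 × Eucl N,
          liminf (fun r : ℝ ↦ ‖u (z.2 + r • (z.1 : Eucl N)) - u z.2‖ₑ ^ p /
            ENNReal.ofReal (r ^ p)) (𝓝[>] 0) ∂((surfaceMeasure N).prod volume) :=
        lintegral_congr fun z ↦ (tendsto_enorm_slope hp (hu z.2) z.1).liminf_eq.symm
    _ ≤ liminf (fun r : ℝ ↦ ∫⁻ z : Metric.sphere (0 : Eucl N) 1 × Eucl N,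
          ‖u (z.2 + r • (z.1 : Eucl N)) - u z.2‖ₑ ^ p /
            ENNReal.ofReal (r ^ p) ∂((surfaceMeasure N).prod volume)) (𝓝[>] 0) :=
        lintegral_liminf_le hf2
    _ = _ := by
        refine liminf_congr ?_
        filter_upwards [self_mem_nhdsWithin] with r hr
        rw [Set.mem_Ioi] at hr
        rw [lintegral_prod _ (hf2 r).aemeasurable]
        have h0 : (ENNReal.ofReal (r ^ p))⁻¹ ≠ ⊤ := by
          simpa using Real.rpow_pos_of_pos hr _
        simp only [div_eq_mul_inv, sphericalShiftEnergy, shiftEnergy]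
        simp_rw [lintegral_mul_const' _ _ h0]

end LowerBound

/-! ### Mollification -/

section Mollify

variable {F : Type*} [NormedAddCommGroup F] [NormedSpace ℝ F] (φ : ContDiffBump (0 : Eucl N))

/-- Mollification by a normalized smooth bump function. -/
noncomputable def mollify (u : Eucl N → F) : Eucl N → F :=
  φ.normed volume ⋆[ContinuousLinearMap.lsmul ℝ ℝ, volume] u

theorem mollify_apply (u : Eucl N → F) (x : Eucl N) :
    mollify φ u x = ∫ t, φ.normed volume t • u (x - t) := rfl

theorem integrable_mollify {u : Eucl N → F} (hu : LocallyIntegrable u volume) (x : Eucl N) :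
    Integrable fun t ↦ φ.normed volume t • u (x - t) :=
  φ.hasCompactSupport_normed.convolutionExists_left (ContinuousLinearMap.lsmul ℝ ℝ)
    φ.continuous_normed hu x

theorem continuous_mollify {u : Eucl N → F} (hu : LocallyIntegrable u volume) :
    Continuous (mollify φ u) :=
  φ.hasCompactSupport_normed.continuous_convolution_left _ φ.continuous_normed hu

theorem mollify_congr_ae {u u' : Eucl N → F} (h : u =ᵐ[volume] u') :
    mollify φ u = mollify φ u' := by
  ext x
  refine integral_congr_ae ?_
  filter_upwards [(quasiMeasurePreserving_sub_left volume x).ae_eq_comp h] with t ht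
  simp only [Function.comp_apply] at ht
  simp [ht]

/-- The probability measure with density a normalized bump function. -/
noncomputable def bumpMeasure : Measure (Eucl N) :=
  volume.withDensity fun t ↦ ENNReal.ofReal (φ.normed volume t)

instance : IsProbabilityMeasure (bumpMeasure φ) where
  measure_univ := by
    rw [bumpMeasure, withDensity_apply _ MeasurableSet.univ, Measure.restrict_univ,
      ← ofReal_integral_eq_lintegral_ofReal φ.integrable_normed (.of_forall φ.nonneg_normed),
      φ.integral_normed, ENNReal.ofReal_one]

theorem integral_bumpMeasure (u : Eucl N → F) :
    ∫ t, u t ∂bumpMeasure φ = ∫ t, φ.normed volume t • u t := by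
  rw [bumpMeasure, integral_withDensity_eq_integral_toReal_smul
    (φ.continuous_normed.measurable.ennreal_ofReal) (by simp)]
  simp [ENNReal.toReal_ofReal (φ.nonneg_normed _)]

/-- Mollification does not increase the `L^p` norm. -/
theorem lintegral_enorm_mollify_rpow_le {p : ℝ} (hp : 1 ≤ p) {u : Eucl N → F}
    (hu : AEStronglyMeasurable u volume) :
    ∫⁻ x, ‖mollify φ u x‖ₑ ^ p ≤ ∫⁻ x, ‖u x‖ₑ ^ p := by
  -- A strongly measurable representative makes `u (x - t)` jointly measurable, as Tonelli requires.
  wlog hm : StronglyMeasurable u generalizing u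
  · rw [mollify_congr_ae φ hu.ae_eq_mk]
    refine (this hu.stronglyMeasurable_mk.aestronglyMeasurable hu.stronglyMeasurable_mk).trans_eq
      (lintegral_congr_ae ?_)
    filter_upwards [hu.ae_eq_mk] with x hx
    rw [hx]
  have hm2 : StronglyMeasurable fun z : Eucl N × Eucl N ↦ u (z.1 - z.2) :=
    hm.comp_measurable (by fun_prop)
  calc ∫⁻ x, ‖mollify φ u x‖ₑ ^ p ≤ ∫⁻ x, ∫⁻ t, ‖u (x - t)‖ₑ ^ p ∂bumpMeasure φ := by
        refine lintegral_mono fun x ↦ ?_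
        rw [mollify_apply, ← integral_bumpMeasure]
        exact enorm_integral_rpow_le hp
          (hm.comp_measurable (by fun_prop)).aestronglyMeasurable
    _ = ∫⁻ t, (∫⁻ x, ‖u (x - t)‖ₑ ^ p) ∂bumpMeasure φ :=
        lintegral_lintegral_swap (hm2.enorm.pow_const p).aemeasurable
    _ = ∫⁻ t, (∫⁻ x, ‖u x‖ₑ ^ p) ∂bumpMeasure φ := by
        refine lintegral_congr fun t ↦ ?_
        exact lintegral_sub_right_eq_self (fun x ↦ ‖u x‖ₑ ^ p) t
    _ = _ := by simp

/-- Mollification commutes with translations and differences, so this is the `L^p` contraction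
applied to `f(· + h) - f`. -/
theorem shiftEnergy_mollify_le {p : ℝ} (hp : 1 ≤ p) {f : Eucl N → ℝ}
    (hf : LocallyIntegrable f volume) (h : Eucl N) :
    shiftEnergy p (mollify φ f) h ≤ shiftEnergy p f h := by
  have hsh : AEStronglyMeasurable (fun y ↦ f (y + h)) volume :=
    hf.aestronglyMeasurable.comp_measurePreserving (measurePreserving_add_right volume h)
  refine le_of_eq_of_le ?_ (lintegral_enorm_mollify_rpow_le φ hp
    (hsh.sub hf.aestronglyMeasurable))
  refine lintegral_congr fun y ↦ ?_
  congr 2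
  rw [mollify_apply, mollify_apply, mollify_apply,
    ← integral_sub (integrable_mollify φ hf _) (integrable_mollify φ hf _)]
  refine integral_congr_ae (.of_forall fun t ↦ ?_)
  simp only [smul_sub]
  congr 3
  abel

theorem gagliardoEnergy_mollify_le (s : ℝ) {p : ℝ} (hp : 1 ≤ p) {f : Eucl N → ℝ}
    (hf : LocallyIntegrable f volume) (hfm : Measurable f) :
    gagliardoEnergy s p (mollify φ f) ≤ gagliardoEnergy s p f := by
  rw [gagliardoEnergy_eq_lintegral_shiftEnergy s p hfm,
    gagliardoEnergy_eq_lintegral_shiftEnergy s p (continuous_mollify φ hf).measurable]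
  gcongr
  exact shiftEnergy_mollify_le φ hp hf _

theorem inner_mollify {g : Eucl N → Eucl N} (hg : LocallyIntegrable g volume) (h x : Eucl N) :
    inner ℝ h (mollify φ g x) = mollify φ (fun y ↦ inner ℝ h (g y)) x := by
  rw [mollify_apply, mollify_apply, ← integral_inner (integrable_mollify φ hg x)]
  simp [inner_smul_right]

theorem contDiff_mollify {f : Eucl N → ℝ} (hf : LocallyIntegrable f volume) :
    ContDiff ℝ 1 (mollify φ f) :=
  φ.hasCompactSupport_normed.contDiff_convolution_left _ (n := 1)
    (φ.contDiff_normed (n := 1)) hf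

/-- The gradient of a mollification is the mollification of the weak gradient. -/
theorem hasGradientAt_mollify {f : Eucl N → ℝ} {g : Eucl N → Eucl N} (h : HasWeakGradient f g)
    (x : Eucl N) : HasGradientAt (mollify φ f) (mollify φ g x) x := by
  obtain ⟨hf, hg, hfg⟩ := h
  set η := φ.normed (volume : Measure (Eucl N)) with hη
  have hη1 : ContDiff ℝ ((⊤ : ℕ∞) : WithTop ℕ∞) η := φ.contDiff_normed
  have hηc : HasCompactSupport η := φ.hasCompactSupport_normed
  have key := hηc.hasFDerivAt_convolution_left (μ := volume) (ContinuousLinearMap.lsmul ℝ ℝ)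
    (hη1.of_le (by exact_mod_cast le_top)) hf x
  have e : InnerProductSpace.toDual ℝ (Eucl N) (mollify φ g x) =
      (fderiv ℝ η ⋆[(ContinuousLinearMap.lsmul ℝ ℝ).precompL (Eucl N), volume] f) x := by
    refine ContinuousLinearMap.coe_injective
      ((EuclideanSpace.basisFun (Fin N) ℝ).toBasis.ext fun i ↦ ?_)
    have hint := hηc.fderiv (𝕜 := ℝ) |>.convolutionExists_left
      ((ContinuousLinearMap.lsmul ℝ ℝ).precompL (Eucl N)) (hη1.continuous_fderiv (by simp)) hf x
    simp only [OrthonormalBasis.coe_toBasis, EuclideanSpace.basisFun_apply,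
      ContinuousLinearMap.coe_coe, InnerProductSpace.toDual_apply_apply]
    rw [convolution_def, ContinuousLinearMap.integral_apply hint, real_inner_comm,
      inner_mollify φ hg, mollify_apply]
    -- The weak gradient is tested against `y ↦ η (x - y)`; the sign from differentiating in `y`
    -- cancels the one from integration by parts.
    have hψ : ContDiff ℝ ((⊤ : ℕ∞) : WithTop ℕ∞) fun y ↦ η (x - y) :=
      hη1.comp (contDiff_const.sub contDiff_id)
    have hψc : HasCompactSupport fun y ↦ η (x - y) :=
      hηc.comp_homeomorph (Homeomorph.subLeft x)
    have hder (y : Eucl N) : fderiv ℝ (fun y ↦ η (x - y)) y = -fderiv ℝ η (x - y) := by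
      have h1 : HasFDerivAt η (fderiv ℝ η (x - y)) (x - y) :=
        (hη1.differentiable (by simp) _).hasFDerivAt
      refine (h1.comp y ((hasFDerivAt_id y).const_sub x)).fderiv.trans ?_
      ext v
      simp
    have := hfg _ hψ hψc i
    simp only [hder, neg_apply, mul_neg, integral_neg, neg_inj] at this
    rw [← integral_sub_left_eq_self (fun y ↦ f y * _) volume x,
      ← integral_sub_left_eq_self (fun y ↦ g y i * _) volume x] at this
    simp only [sub_sub_cancel] at this
    simp only [ContinuousLinearMap.precompL_apply,
      ContinuousLinearMap.lsmul_apply, smul_eq_mul]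
    simp only [EuclideanSpace.inner_single_left, map_one, one_mul]
    rw [← hη]
    simp only [mul_comm] at this ⊢
    exact this.symm
  rw [hasGradientAt_iff_hasFDerivAt, e]
  exact key

end Mollify

/-! ### Upper bound and the limit for Sobolev functions -/

section UpperBound

/-- Integrate the derivative along the segment from `y` to `y + h`, apply Jensen in the parameter
`t`, then use translation invariance in `y`. -/
theorem shiftEnergy_le_of_hasGradientAt {p : ℝ} (hp : 1 ≤ p) {u : Eucl N → ℝ}
    {G : Eucl N → Eucl N} (hG : Continuous G) (hu : ∀ y, HasGradientAt u (G y) y) (h : Eucl N) :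
    shiftEnergy p u h ≤ ∫⁻ y, ‖inner ℝ h (G y)‖ₑ ^ p := by
  have : IsProbabilityMeasure (volume.restrict (Set.Ioc (0 : ℝ) 1)) := ⟨by simp⟩
  have hftc (y : Eucl N) :
      ∫ t in Set.Ioc (0 : ℝ) 1, inner ℝ h (G (y + t • h)) = u (y + h) - u y := by
    have hd (t : ℝ) : HasDerivAt (fun t : ℝ ↦ u (y + t • h)) (inner ℝ h (G (y + t • h))) t := by
      have h2 : HasDerivAt (fun t : ℝ ↦ y + t • h) h t := by
        simpa using ((hasDerivAt_id t).smul_const h).const_add y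
      have h3 := (hu (y + t • h)).hasFDerivAt.comp_hasDerivAt t h2
      rw [InnerProductSpace.toDual_apply_apply, real_inner_comm] at h3
      exact h3
    rw [← intervalIntegral.integral_of_le zero_le_one,
      intervalIntegral.integral_eq_sub_of_hasDerivAt (fun t _ ↦ hd t)
        (Continuous.intervalIntegrable (by fun_prop) _ _)]
    simp
  calc shiftEnergy p u h
      ≤ ∫⁻ y, ∫⁻ t in Set.Ioc (0 : ℝ) 1, ‖inner ℝ h (G (y + t • h))‖ₑ ^ p := by
        refine lintegral_mono fun y ↦ ?_
        rw [← hftc]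
        exact enorm_integral_rpow_le hp (Continuous.aestronglyMeasurable (by fun_prop))
    _ = ∫⁻ t in Set.Ioc (0 : ℝ) 1, ∫⁻ y, ‖inner ℝ h (G (y + t • h))‖ₑ ^ p := by
        refine lintegral_lintegral_swap ?_
        have : Continuous fun z : Eucl N × ℝ ↦ inner ℝ h (G (z.1 + z.2 • h)) := by fun_prop
        exact (this.measurable.enorm.pow_const p).aemeasurable
    _ = ∫⁻ t in Set.Ioc (0 : ℝ) 1, ∫⁻ y, ‖inner ℝ h (G y)‖ₑ ^ p :=
        lintegral_congr fun t ↦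
          lintegral_add_right_eq_self (fun y ↦ ‖inner ℝ h (G y)‖ₑ ^ p) (t • h)
    _ = _ := by simp

/-- A sequence of bump functions shrinking to the origin. -/
noncomputable def bumpSeq (N n : ℕ) : ContDiffBump (0 : Eucl N) where
  rIn := 1 / ((n : ℝ) + 1)
  rOut := 2 * (1 / ((n : ℝ) + 1))
  rIn_pos := by positivity
  rIn_lt_rOut := by
    have : 0 < 1 / ((n : ℝ) + 1) := by positivity
    linarith

theorem tendsto_bumpSeq_rOut : Tendsto (fun n ↦ (bumpSeq N n).rOut) atTop (𝓝 0) := by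
  simpa [bumpSeq] using (tendsto_one_div_add_atTop_nhds_zero_nat (𝕜 := ℝ)).const_mul 2

variable {F : Type*} [NormedAddCommGroup F] [NormedSpace ℝ F] [CompleteSpace F]

theorem ae_tendsto_mollify_bumpSeq {u : Eucl N → F} (hu : LocallyIntegrable u volume) :
    ∀ᵐ x, Tendsto (fun n ↦ mollify (bumpSeq N n) u x) atTop (𝓝 (u x)) :=
  ContDiffBump.ae_convolution_tendsto_right_of_locallyIntegrable (K := 2) tendsto_bumpSeq_rOut
    (.of_forall fun _ ↦ le_rfl) hu

/-- Mollifications converge almost everywhere, so Fatou's lemma transfers the bound. -/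
theorem lintegral_rpow_le_of_mollify_le (p : ℝ) {u : Eucl N → F}
    (hu : LocallyIntegrable u volume) {C : ℝ≥0∞}
    (hC : ∀ n, ∫⁻ x, ‖mollify (bumpSeq N n) u x‖ₑ ^ p ≤ C) : ∫⁻ x, ‖u x‖ₑ ^ p ≤ C := by
  calc ∫⁻ x, ‖u x‖ₑ ^ p
      = ∫⁻ x, liminf (fun n ↦ ‖mollify (bumpSeq N n) u x‖ₑ ^ p) atTop := by
        refine lintegral_congr_ae ?_
        filter_upwards [ae_tendsto_mollify_bumpSeq hu] with x hx
        exact ((ENNReal.continuous_rpow_const (y := p)).continuousAt.tendsto.comp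
          (continuous_enorm.continuousAt.tendsto.comp hx)).liminf_eq.symm
    _ ≤ liminf (fun n ↦ ∫⁻ x, ‖mollify (bumpSeq N n) u x‖ₑ ^ p) atTop :=
        lintegral_liminf_le fun n ↦ by
          have := continuous_mollify (bumpSeq N n) hu
          exact (continuous_enorm.comp this).measurable.pow_const p
    _ ≤ C := liminf_le_of_le (by isBoundedDefault) fun b hb ↦ by
        obtain ⟨n, hn⟩ := hb.exists
        exact hn.trans (hC n)

/-- The smooth estimate holds for every mollification with a bound independent of `n`, because
mollifying `inner ℝ v (g y)` is a contraction; Fatou's lemma then returns to `f`. -/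
theorem shiftEnergy_le_of_hasWeakGradient {p : ℝ} (hp : 1 ≤ p) {f : Eucl N → ℝ}
    {g : Eucl N → Eucl N} (h : HasWeakGradient f g) (v : Eucl N) :
    shiftEnergy p f v ≤ ∫⁻ y, ‖inner ℝ v (g y)‖ₑ ^ p := by
  have hf := h.1
  have hg := h.2.1
  have hbound (n : ℕ) : shiftEnergy p (mollify (bumpSeq N n) f) v ≤
      ∫⁻ y, ‖inner ℝ v (g y)‖ₑ ^ p := by
    refine (shiftEnergy_le_of_hasGradientAt hp (continuous_mollify (bumpSeq N n) hg)
      (hasGradientAt_mollify (bumpSeq N n) h) v).trans ?_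
    simp only [inner_mollify (bumpSeq N n) hg]
    exact lintegral_enorm_mollify_rpow_le _ hp
      (aestronglyMeasurable_const.inner hg.aestronglyMeasurable)
  have hae := ae_tendsto_mollify_bumpSeq hf
  have hae' := (measurePreserving_add_right volume v).quasiMeasurePreserving.ae hae
  calc shiftEnergy p f v
      = ∫⁻ y, liminf (fun n ↦ ‖mollify (bumpSeq N n) f (y + v) -
          mollify (bumpSeq N n) f y‖ₑ ^ p) atTop := by
        refine lintegral_congr_ae ?_
        filter_upwards [hae, hae'] with y hy hy'
        exact ((ENNReal.continuous_rpow_const (y := p)).continuousAt.tendsto.comp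
          (continuous_enorm.continuousAt.tendsto.comp (hy'.sub hy))).liminf_eq.symm
    _ ≤ liminf (fun n ↦ shiftEnergy p (mollify (bumpSeq N n) f) v) atTop :=
        lintegral_liminf_le fun n ↦ by
          have := continuous_mollify (bumpSeq N n) hf
          have h2 : Continuous fun y ↦ mollify (bumpSeq N n) f (y + v) -
            mollify (bumpSeq N n) f y := by fun_prop
          exact (continuous_enorm.comp h2).measurable.pow_const p
    _ ≤ _ := liminf_le_of_le (by isBoundedDefault) fun b hb ↦ by
        obtain ⟨n, hn⟩ := hb.exists
        exact hn.trans (hbound n)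

theorem shiftEnergy_le_eLpNorm {p : ℝ} (hp : 1 ≤ p) {f : Eucl N → ℝ}
    (hf : AEStronglyMeasurable f volume) (v : Eucl N) :
    shiftEnergy p f v ≤ (2 * eLpNorm f (ENNReal.ofReal p) volume) ^ p := by
  have hp0 : 0 < p := by linarith
  have hmp := measurePreserving_add_right (volume : Measure (Eucl N)) v
  have hsh : AEStronglyMeasurable (fun y ↦ f (y + v)) volume := hf.comp_measurePreserving hmp
  have e : shiftEnergy p f v =
      eLpNorm ((fun y ↦ f (y + v)) - f) (ENNReal.ofReal p) volume ^ p :=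
    (eLpNorm_ofReal_rpow hp0 _).symm
  rw [e]
  gcongr
  refine (eLpNorm_sub_le hsh hf (by simpa using hp)).trans_eq ?_
  have : eLpNorm (fun y ↦ f (y + v)) (ENNReal.ofReal p) volume =
      eLpNorm f (ENNReal.ofReal p) volume := eLpNorm_comp_measurePreserving hf hmp
  rw [this, two_mul]

/-- Integrating the directional bound over the sphere first, for fixed `y`, produces the sharp
constant: the same one as in the lower bound. -/
theorem sphericalShiftEnergy_le {p : ℝ} (hN : 1 ≤ N) (hp : 1 ≤ p) {e : Eucl N} (he : ‖e‖ = 1)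
    {f : Eucl N → ℝ} {g : Eucl N → Eucl N} (h : HasWeakGradient f g) {r : ℝ} (hr : 0 < r) :
    sphericalShiftEnergy p f r ≤
      ENNReal.ofReal (r ^ p) * (ENNReal.ofReal (sphereConst p e) * ∫⁻ y, ‖g y‖ₑ ^ p) := by
  have hp0 : 0 < p := by linarith
  have hgm := h.2.1.aestronglyMeasurable
  calc sphericalShiftEnergy p f r
      ≤ ∫⁻ w, (∫⁻ y, ‖inner ℝ (r • (w : Eucl N)) (g y)‖ₑ ^ p) ∂surfaceMeasure N :=
        lintegral_mono fun w ↦ shiftEnergy_le_of_hasWeakGradient hp h _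
    _ = ∫⁻ y, ∫⁻ w, ‖inner ℝ (r • (w : Eucl N)) (g y)‖ₑ ^ p ∂surfaceMeasure N := by
        refine lintegral_lintegral_swap ?_
        have h1 : AEStronglyMeasurable (fun z : Metric.sphere (0 : Eucl N) 1 × Eucl N ↦ g z.2)
          ((surfaceMeasure N).prod volume) := hgm.comp_snd
        have h2 : AEStronglyMeasurable (fun z : Metric.sphere (0 : Eucl N) 1 × Eucl N ↦
          r • (z.1 : Eucl N)) ((surfaceMeasure N).prod volume) :=
          Continuous.aestronglyMeasurable (by fun_prop)
        exact (h2.inner h1).enorm.pow_const p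
    _ = ∫⁻ y, ENNReal.ofReal (r ^ p) * sphereMoment p (g y) := by
        refine lintegral_congr fun y ↦ ?_
        rw [sphereMoment, ← lintegral_const_mul' _ _ ENNReal.ofReal_ne_top]
        refine lintegral_congr fun w ↦ ?_
        rw [real_inner_smul_left, real_inner_comm, enorm_mul,
          ENNReal.mul_rpow_of_nonneg _ _ hp0.le, Real.enorm_of_nonneg hr.le,
          ENNReal.ofReal_rpow_of_pos hr]
    _ = _ := by
        simp only [sphereMoment_eq hN hp0 he]
        rw [lintegral_const_mul' _ _ ENNReal.ofReal_ne_top,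
          lintegral_const_mul' _ _ ENNReal.ofReal_ne_top]

/-- The limit of the rescaled energies of a Sobolev function. -/
theorem tendsto_gagliardoEnergy (hN : 1 ≤ N) {p : ℝ} (hp : 1 ≤ p) {e : Eucl N} (he : ‖e‖ = 1)
    {f : Eucl N → ℝ} (hfm : Measurable f) (hf : MemLp f (ENNReal.ofReal p) volume)
    {g : Eucl N → Eucl N} (h : HasWeakGradient f g)
    (hg : ∫⁻ y, ‖g y‖ₑ ^ p < ⊤) :
    Tendsto (fun s ↦ ENNReal.ofReal (1 - s) * gagliardoEnergy s p f) (𝓝[<] 1)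
      (𝓝 (ENNReal.ofReal (sphereConst p e) * (∫⁻ y, ‖g y‖ₑ ^ p) * ENNReal.ofReal (1 / p))) := by
  have hp0 : 0 < p := by linarith
  have hK := sphereConst_pos hp0 he
  refine tendsto_of_le_liminf_of_limsup_le ?_ ?_
  · set L := liminf (fun s ↦ ENNReal.ofReal (1 - s) * gagliardoEnergy s p f) (𝓝[<] 1)
    have hc0 : ENNReal.ofReal (sphereConst p e) * ENNReal.ofReal (1 / p) ≠ 0 := by
      simpa using ⟨hK, hp0⟩
    have hct : ENNReal.ofReal (sphereConst p e) * ENNReal.ofReal (1 / p) ≠ ⊤ :=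
      ENNReal.mul_ne_top ENNReal.ofReal_ne_top ENNReal.ofReal_ne_top
    -- Isolating `∫ |g|^p` reduces the claim to a bound on each mollification of `g`, which is the
    -- gradient of the mollified `f`.
    rw [mul_right_comm, mul_comm, ← ENNReal.le_div_iff_mul_le (.inl hc0) (.inl hct)]
    refine lintegral_rpow_le_of_mollify_le p h.2.1 fun n ↦ ?_
    rw [ENNReal.le_div_iff_mul_le (.inl hc0) (.inl hct), mul_comm, mul_right_comm]
    refine (le_liminf_gagliardoEnergy hN hp0 he (continuous_mollify (bumpSeq N n) h.2.1)
      (hasGradientAt_mollify (bumpSeq N n) h)).trans ?_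
    refine liminf_le_liminf (.of_forall fun s ↦ ?_)
    gcongr
    exact gagliardoEnergy_mollify_le _ _ hp h.1 hfm
  · simp only [gagliardoEnergy_eq_radial hN _ p hfm]
    refine limsup_radial_le hp0 (B := (2 * eLpNorm f (ENNReal.ofReal p) volume) ^ p *
      surfaceMeasure N Set.univ) (ENNReal.mul_ne_top ENNReal.ofReal_ne_top hg.ne) ?_
      (fun r hr ↦ sphericalShiftEnergy_le hN hp he h hr) fun r _ ↦ ?_
    · refine ENNReal.mul_ne_top (ENNReal.rpow_ne_top_of_nonneg hp0.le
        (ENNReal.mul_ne_top (by simp) hf.eLpNorm_ne_top)) (measure_ne_top _ _)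
    · rw [← lintegral_const]
      exact lintegral_mono fun w ↦ shiftEnergy_le_eLpNorm hp hf.1 _

end UpperBound

/-! ### Weak limits of sequences bounded in `L^p` -/

section WeakCompactness

theorem enorm_integral_mul_le_Lp_mul_Lq {p q : ℝ} (hpq : p.HolderConjugate q)
    {u v : Eucl N → ℝ} (hu : AEStronglyMeasurable u volume) (hv : AEStronglyMeasurable v volume) :
    ‖∫ x, u x * v x‖ₑ ≤ (∫⁻ x, ‖u x‖ₑ ^ p) ^ (1 / p) * (∫⁻ x, ‖v x‖ₑ ^ q) ^ (1 / q) := by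
  refine (enorm_integral_le_lintegral_enorm _).trans ?_
  simp only [enorm_mul]
  exact ENNReal.lintegral_mul_le_Lp_mul_Lq volume hpq hu.enorm hv.enorm

theorem lintegral_enorm_rpow_ne_top_of_hasCompactSupport {q : ℝ} (hq : 0 < q) {ψ : Eucl N → ℝ}
    (hψ : Continuous ψ) (hc : HasCompactSupport ψ) : ∫⁻ x, ‖ψ x‖ₑ ^ q ≠ ⊤ := by
  rw [← eLpNorm_ofReal_rpow hq]
  exact ENNReal.rpow_ne_top_of_nonneg hq.le (hψ.memLp_of_hasCompactSupport hc).eLpNorm_ne_top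

/-- A nonnegative functional on `C_c` bounded by an `L^q` norm, `q < ∞`, is represented by a
measure which is absolutely continuous with respect to Lebesgue measure. -/
theorem rieszMeasure_absolutelyContinuous {q : ℝ} (hq : 0 < q)
    (Λ : C_c(Eucl N, ℝ) →ₚ[ℝ] ℝ) {C : ℝ≥0∞} (hC : C ≠ ⊤)
    (hΛ : ∀ ψ : C_c(Eucl N, ℝ), ENNReal.ofReal (Λ ψ) ≤ C * (∫⁻ x, ‖ψ x‖ₑ ^ q) ^ (1 / q)) :
    RealRMK.rieszMeasure Λ ≪ volume := by
  have hopen (U : Set (Eucl N)) (hU : IsOpen U) :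
      RealRMK.rieszMeasure Λ U ≤ C * volume U ^ (1 / q) := by
    rw [hU.measure_eq_iSup_isCompact]
    refine iSup₂_le fun K hKU ↦ iSup_le fun hK ↦ ?_
    -- A Urysohn function equal to `1` on `K` and supported in `U` has `L^q` norm at most `volume U
    -- ^ (1 / q)`.
    obtain ⟨f, hf1, hf2, hf3, hf4⟩ := exists_continuousMap_one_of_isCompact_subset_isOpen hK hU hKU
    refine (RealRMK.rieszMeasure_le_of_eq_one Λ (f := ⟨f, hf2⟩) (fun x ↦ (hf4 x).1) hK
      fun x hx ↦ hf1 hx).trans ((hΛ _).trans ?_)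
    gcongr
    rw [← lintegral_indicator_one hU.measurableSet]
    refine lintegral_mono fun x ↦ ?_
    change ‖f x‖ₑ ^ q ≤ _
    by_cases hx : x ∈ U
    · rw [Set.indicator_of_mem hx, Pi.one_apply]
      refine ENNReal.rpow_le_one ?_ hq.le
      rw [Real.enorm_of_nonneg (hf4 x).1, ENNReal.ofReal_le_one]
      exact (hf4 x).2
    · rw [image_eq_zero_of_notMem_tsupport fun h ↦ hx (hf3 h)]
      simp [hq]
  refine Measure.AbsolutelyContinuous.mk fun A _ hA ↦ ?_
  -- Outer regularity covers a null set by open sets of small volume; since `1 / q > 0`, the bound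
  -- tends to `0` with `ε`.
  have hle (ε : ℝ≥0∞) (hε : 0 < ε) : RealRMK.rieszMeasure Λ A ≤ C * ε ^ (1 / q) := by
    obtain ⟨U, hAU, hU, hUε⟩ := Set.exists_isOpen_lt_of_lt A ε (by rwa [hA])
    refine (measure_mono hAU).trans ((hopen U hU).trans ?_)
    gcongr
  have hlim : Tendsto (fun ε : ℝ≥0∞ ↦ C * ε ^ (1 / q)) (𝓝[>] 0) (𝓝 (C * 0 ^ (1 / q))) :=
    ENNReal.Tendsto.const_mul ((ENNReal.continuous_rpow_const.tendsto 0).mono_left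
      nhdsWithin_le_nhds) (.inr hC)
  rw [ENNReal.zero_rpow_of_pos (by positivity), mul_zero] at hlim
  refine le_antisymm (ge_of_tendsto hlim ?_) zero_le
  filter_upwards [self_mem_nhdsWithin] with ε hε using hle ε hε

/-- Along an ultrafilter every bounded real sequence converges, so no subsequence has to be
extracted. The limits form a positive functional on `C_c`, hence a measure by Riesz–Markov–Kakutani;
Hölder makes it absolutely continuous, and `g` is its Radon–Nikodym density. -/
theorem exists_tendsto_integral_of_nonneg {p : ℝ} (hp : 1 < p) {u : ℕ → Eucl N → ℝ}
    (hu : ∀ n, LocallyIntegrable (u n) volume) (hu0 : ∀ n x, 0 ≤ u n x) {C : ℝ≥0∞} (hC : C ≠ ⊤)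
    (hb : ∀ n, ∫⁻ x, ‖u n x‖ₑ ^ p ≤ C) (𝒰 : Ultrafilter ℕ) :
    ∃ g : Eucl N → ℝ, LocallyIntegrable g volume ∧ ∀ ψ : C_c(Eucl N, ℝ),
      Tendsto (fun n ↦ ∫ x, u n x * ψ x) 𝒰 (𝓝 (∫ x, g x * ψ x)) := by
  set q := p.conjExponent with hq
  have hpq : p.HolderConjugate q := Real.HolderConjugate.conjExponent hp
  have hC' : C ^ (1 / p) ≠ ⊤ := ENNReal.rpow_ne_top_of_nonneg (by positivity) hC
  have hbound (n : ℕ) (ψ : C_c(Eucl N, ℝ)) :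
      ‖∫ x, u n x * ψ x‖ₑ ≤ C ^ (1 / p) * (∫⁻ x, ‖ψ x‖ₑ ^ q) ^ (1 / q) := by
    refine (enorm_integral_mul_le_Lp_mul_Lq hpq (hu n).aestronglyMeasurable
      ψ.continuous.aestronglyMeasurable).trans ?_
    exact mul_le_mul' (ENNReal.rpow_le_rpow (hb n) (by positivity)) le_rfl
  have hint (n : ℕ) (ψ : C_c(Eucl N, ℝ)) : Integrable fun x ↦ u n x * ψ x :=
    (hu n).integrable_smul_right_of_hasCompactSupport ψ.continuous ψ.hasCompactSupport
  have hex (ψ : C_c(Eucl N, ℝ)) : ∃ a, Tendsto (fun n ↦ ∫ x, u n x * ψ x) 𝒰 (𝓝 a) := by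
    set M := C ^ (1 / p) * (∫⁻ x, ‖ψ x‖ₑ ^ q) ^ (1 / q) with hM
    have hMt : M ≠ ⊤ := ENNReal.mul_ne_top hC' (ENNReal.rpow_ne_top_of_nonneg
      (by have := hpq.symm.pos; positivity)
      (lintegral_enorm_rpow_ne_top_of_hasCompactSupport hpq.symm.pos ψ.continuous
        ψ.hasCompactSupport))
    obtain ⟨a, -, ha⟩ := (isCompact_closedBall (0 : ℝ) M.toReal).ultrafilter_le_nhds
      (𝒰.map fun n ↦ ∫ x, u n x * ψ x) (by
        rw [Ultrafilter.coe_map, le_principal_iff, mem_map]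
        refine univ_mem' fun n ↦ ?_
        rw [Set.mem_preimage, mem_closedBall_zero_iff, ← toReal_enorm]
        exact ENNReal.toReal_mono hMt (hbound n ψ))
    exact ⟨a, ha⟩
  choose Λ₀ hΛ₀ using hex
  set Λ : C_c(Eucl N, ℝ) →ₚ[ℝ] ℝ := PositiveLinearMap.mk₀
    { toFun := Λ₀
      map_add' := fun ψ χ ↦ by
        refine tendsto_nhds_unique (hΛ₀ (ψ + χ)) (((hΛ₀ ψ).add (hΛ₀ χ)).congr fun n ↦ ?_)
        rw [← integral_add (hint n ψ) (hint n χ)]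
        simp [mul_add]
      map_smul' := fun c ψ ↦ by
        refine tendsto_nhds_unique (hΛ₀ (c • ψ)) (((hΛ₀ ψ).const_mul c).congr fun n ↦ ?_)
        rw [← integral_const_mul]
        simp [mul_left_comm] }
    (fun ψ hψ ↦ ge_of_tendsto' (hΛ₀ ψ) fun n ↦
      integral_nonneg fun x ↦ mul_nonneg (hu0 n x) (hψ x)) with hΛ
  have hΛb (ψ : C_c(Eucl N, ℝ)) :
      ENNReal.ofReal (Λ ψ) ≤ C ^ (1 / p) * (∫⁻ x, ‖ψ x‖ₑ ^ q) ^ (1 / q) := by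
    refine le_of_tendsto' (ENNReal.tendsto_ofReal (hΛ₀ ψ)) fun n ↦ ?_
    exact (Real.ofReal_le_enorm _).trans (hbound n ψ)
  set μ := RealRMK.rieszMeasure Λ
  have hac : μ ≪ volume := rieszMeasure_absolutelyContinuous hpq.symm.pos Λ hC' hΛb
  refine ⟨fun x ↦ (μ.rnDeriv volume x).toReal, ?_, fun ψ ↦ ?_⟩
  · rw [locallyIntegrable_iff]
    intro K hK
    exact Measure.integrableOn_toReal_rnDeriv hK.measure_ne_top
  · have h1 := integral_rnDeriv_smul hac (f := ψ)
    simp only [smul_eq_mul] at h1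
    rw [h1, RealRMK.integral_rieszMeasure Λ ψ]
    exact hΛ₀ ψ

theorem norm_max_zero_le (a : ℝ) : ‖max a 0‖ ≤ ‖a‖ := by
  rw [Real.norm_eq_abs, Real.norm_eq_abs, abs_of_nonneg (le_max_right _ _)]
  exact max_le (le_abs_self _) (abs_nonneg _)

theorem locallyIntegrable_max_zero {v : Eucl N → ℝ} (hv : LocallyIntegrable v volume) :
    LocallyIntegrable (fun x ↦ max (v x) 0) volume :=
  hv.mono (hv.aestronglyMeasurable.sup aestronglyMeasurable_const)
    (.of_forall fun x ↦ norm_max_zero_le (v x))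

/-- Sequential weak compactness of bounded sequences in `L^p`, tested against `C_c`. -/
theorem exists_tendsto_integral {p : ℝ} (hp : 1 < p) {u : ℕ → Eucl N → ℝ}
    (hu : ∀ n, LocallyIntegrable (u n) volume) {C : ℝ≥0∞} (hC : C ≠ ⊤)
    (hb : ∀ n, ∫⁻ x, ‖u n x‖ₑ ^ p ≤ C) (𝒰 : Ultrafilter ℕ) :
    ∃ g : Eucl N → ℝ, LocallyIntegrable g volume ∧ ∀ ψ : C_c(Eucl N, ℝ),
      Tendsto (fun n ↦ ∫ x, u n x * ψ x) 𝒰 (𝓝 (∫ x, g x * ψ x)) := by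
  have hp0 : 0 ≤ p := by linarith
  -- Applied to `u` and to `-u`, this treats the positive and negative parts separately.
  have hpos (v : ℕ → Eucl N → ℝ) (hv : ∀ n, LocallyIntegrable (v n) volume)
      (hvb : ∀ n, ∫⁻ x, ‖v n x‖ₑ ^ p ≤ C) :=
    exists_tendsto_integral_of_nonneg hp (u := fun n x ↦ max (v n x) 0)
      (fun n ↦ locallyIntegrable_max_zero (hv n))
      (fun n x ↦ le_max_right _ _) hC
      (fun n ↦ (lintegral_mono fun x ↦ by
        gcongr
        exact enorm_le_iff_norm_le.2 (norm_max_zero_le _)).trans (hvb n)) 𝒰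
  obtain ⟨g₁, hg₁, h₁⟩ := hpos u hu hb
  obtain ⟨g₂, hg₂, h₂⟩ := hpos (fun n x ↦ -u n x) (fun n ↦ (hu n).neg) (by simpa using hb)
  have hint {v : Eucl N → ℝ} (hv : LocallyIntegrable v volume) (ψ : C_c(Eucl N, ℝ)) :
      Integrable fun x ↦ v x * ψ x :=
    hv.integrable_smul_right_of_hasCompactSupport ψ.continuous ψ.hasCompactSupport
  refine ⟨fun x ↦ g₁ x - g₂ x, hg₁.sub hg₂, fun ψ ↦ ?_⟩
  simp only [sub_mul]
  rw [integral_sub (hint hg₁ ψ) (hint hg₂ ψ)]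
  refine ((h₁ ψ).sub (h₂ ψ)).congr fun n ↦ ?_
  rw [← integral_sub (hint (locallyIntegrable_max_zero (hu n)) ψ)
    (hint (v := fun x ↦ max (-u n x) 0) (locallyIntegrable_max_zero (hu n).neg) ψ)]
  refine integral_congr_ae (.of_forall fun x ↦ ?_)
  simp only [← sub_mul]
  congr 1
  rcases le_total (u n x) 0 with h | h
  · rw [max_eq_right h, max_eq_left (by linarith)]; ring
  · rw [max_eq_left h, max_eq_right (by linarith)]; ring

end WeakCompactness

/-! ### Existence of the weak gradient -/

section Existence

/-- With `χ'(x) = χ(-x)`, the pairing is a convolution with `χ'` evaluated at `0`. By associativity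
it is the mollification at `0` of the continuous function `f ⋆ χ'`. -/
theorem tendsto_integral_mollify_mul {f χ : Eucl N → ℝ} (hf : LocallyIntegrable f volume)
    (hχ : Continuous χ) (hχc : HasCompactSupport χ) :
    Tendsto (fun n ↦ ∫ x, mollify (bumpSeq N n) f x * χ x) atTop (𝓝 (∫ x, f x * χ x)) := by
  have hfn : LocallyIntegrable (fun x ↦ ‖f x‖) volume := fun x ↦ (hf x).norm
  set χ' : Eucl N → ℝ := fun x ↦ χ (-x)
  have hχ' : Continuous χ' := hχ.comp continuous_neg
  have hχc' : HasCompactSupport χ' := hχc.comp_homeomorph (Homeomorph.neg _)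
  have hz (v : Eucl N → ℝ) : (v ⋆[ContinuousLinearMap.mul ℝ ℝ, volume] χ') 0 =
      ∫ x, v x * χ x := by
    simp [convolution_def, χ']
  have hc : Continuous (f ⋆[ContinuousLinearMap.mul ℝ ℝ, volume] χ') :=
    hχc'.continuous_convolution_right _ hf hχ'
  have hc2 : Continuous ((fun x ↦ ‖f x‖) ⋆[ContinuousLinearMap.mul ℝ ℝ, volume]
      fun x ↦ ‖χ' x‖) :=
    hχc'.norm.continuous_convolution_right _ hfn hχ'.norm
  have hlim := ContDiffBump.convolution_tendsto_right_of_continuous (μ := volume)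
    (tendsto_bumpSeq_rOut (N := N)) hc 0
  rw [hz f] at hlim
  refine hlim.congr fun n ↦ ?_
  rw [← hz, mollify]
  refine (convolution_assoc (ContinuousLinearMap.lsmul ℝ ℝ) (ContinuousLinearMap.mul ℝ ℝ)
    (ContinuousLinearMap.lsmul ℝ ℝ) (ContinuousLinearMap.mul ℝ ℝ)
    (fun x y z ↦ by simp [mul_assoc]) (bumpSeq N n).continuous_normed.aestronglyMeasurable
    hf.aestronglyMeasurable hχ'.aestronglyMeasurable (.of_forall fun y ↦ ?_)
    (.of_forall fun y ↦ ?_) ?_).symm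
  · exact (bumpSeq N n).hasCompactSupport_normed.convolutionExists_left _
      (bumpSeq N n).continuous_normed hf y
  · exact hχc'.norm.convolutionExists_right _ hfn hχ'.norm y
  · exact (bumpSeq N n).hasCompactSupport_normed.norm.convolutionExists_left _
      (bumpSeq N n).continuous_normed.norm hc2.locallyIntegrable 0

theorem hasGradientAt_gradient_mollify (φ : ContDiffBump (0 : Eucl N)) {f : Eucl N → ℝ}
    (hf : LocallyIntegrable f volume) (x : Eucl N) :
    HasGradientAt (mollify φ f) (gradient (mollify φ f) x) x :=
  ((contDiff_mollify φ hf).differentiable (by simp) x).hasGradientAt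

theorem continuous_gradient_mollify (φ : ContDiffBump (0 : Eucl N)) {f : Eucl N → ℝ}
    (hf : LocallyIntegrable f volume) : Continuous (gradient (mollify φ f)) :=
  (InnerProductSpace.toDual ℝ (Eucl N)).symm.continuous.comp
    ((contDiff_mollify φ hf).continuous_fderiv (by simp))

theorem gradient_mollify_apply (φ : ContDiffBump (0 : Eucl N)) {f : Eucl N → ℝ}
    (hf : LocallyIntegrable f volume) (x : Eucl N) (i : Fin N) :
    gradient (mollify φ f) x i = fderiv ℝ (mollify φ f) x (EuclideanSpace.single i 1) := by
  rw [(hasGradientAt_gradient_mollify φ hf x).hasFDerivAt.fderiv,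
    InnerProductSpace.toDual_apply_apply, real_inner_comm,
    EuclideanSpace.inner_single_left, map_one, one_mul]

theorem integral_gradient_mollify_mul (φ : ContDiffBump (0 : Eucl N)) {f ψ : Eucl N → ℝ}
    (hf : LocallyIntegrable f volume) (hψ : ContDiff ℝ ((⊤ : ℕ∞) : WithTop ℕ∞) ψ)
    (hψc : HasCompactSupport ψ) (i : Fin N) :
    ∫ x, gradient (mollify φ f) x i * ψ x =
      -∫ x, mollify φ f x * fderiv ℝ ψ x (EuclideanSpace.single i 1) := by
  have hdψ : Continuous fun x ↦ fderiv ℝ ψ x (EuclideanSpace.single i 1) :=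
    (hψ.continuous_fderiv (by simp)).clm_apply continuous_const
  have hdψc : HasCompactSupport fun x ↦ fderiv ℝ ψ x (EuclideanSpace.single i 1) :=
    hψc.fderiv_apply (𝕜 := ℝ) _
  have hm := continuous_mollify φ hf
  have hg : Continuous fun x ↦ gradient (mollify φ f) x i :=
    (EuclideanSpace.proj i).continuous.comp (continuous_gradient_mollify φ hf)
  simp only [gradient_mollify_apply φ hf] at hg ⊢
  rw [integral_mul_fderiv_eq_neg_fderiv_mul_of_integrable
    ((hg.mul hψ.continuous).integrable_of_hasCompactSupport hψc.mul_left)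
    ((hm.mul hdψ).integrable_of_hasCompactSupport hdψc.mul_left)
    ((hm.mul hψ.continuous).integrable_of_hasCompactSupport hψc.mul_left)
    (fun x _ ↦ (contDiff_mollify φ hf).differentiable (by simp) x)
    (fun x _ ↦ hψ.differentiable (by simp) x), neg_neg]

/-- If the gradients of the mollifications are bounded in `L^p`, `p > 1`, then the weak gradient
exists and satisfies the same bound. -/
theorem exists_hasWeakGradient {p : ℝ} (hp : 1 < p) {f : Eucl N → ℝ}
    (hf : LocallyIntegrable f volume) {C : ℝ≥0∞} (hC : C ≠ ⊤)
    (hb : ∀ n, ∫⁻ x, ‖gradient (mollify (bumpSeq N n) f) x‖ₑ ^ p ≤ C) :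
    ∃ g : Eucl N → Eucl N, HasWeakGradient f g ∧ ∫⁻ x, ‖g x‖ₑ ^ p ≤ C := by
  have hi (i : Fin N) : ∃ g : Eucl N → ℝ, LocallyIntegrable g volume ∧ ∀ ψ : C_c(Eucl N, ℝ),
      Tendsto (fun n ↦ ∫ x, gradient (mollify (bumpSeq N n) f) x i * ψ x)
        (hyperfilter ℕ) (𝓝 (∫ x, g x * ψ x)) := by
    refine exists_tendsto_integral hp (fun n ↦ ?_) hC (fun n ↦ (lintegral_mono fun x ↦ ?_).trans
      (hb n)) _
    · exact ((EuclideanSpace.proj i).continuous.comp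
        (continuous_gradient_mollify (bumpSeq N n) hf)).locallyIntegrable
    · gcongr
      exact enorm_le_iff_norm_le.2 (PiLp.norm_apply_le _ i)
  choose g hg hlim using hi
  set G : Eucl N → Eucl N := fun x ↦ WithLp.toLp 2 fun i ↦ g i x
  have hG : HasWeakGradient f G := by
    refine ⟨hf, ?_, fun ψ hψ hψc i ↦ ?_⟩
    · have e : G = fun x ↦ ∑ i, g i x • (EuclideanSpace.single i 1 : Eucl N) := by
        ext x j
        simp [G, Finset.sum_apply, Pi.single_apply]
      rw [e, locallyIntegrable_iff]
      intro K hK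
      exact integrable_finsetSum _ fun i _ ↦ ((hg i).integrableOn_isCompact hK).smul_const _
    · have hdψ : Continuous fun x ↦ fderiv ℝ ψ x (EuclideanSpace.single i 1) :=
        (hψ.continuous_fderiv (by simp)).clm_apply continuous_const
      have h1 := (tendsto_integral_mollify_mul hf hdψ (hψc.fderiv_apply (𝕜 := ℝ) _)).neg
      have h2 := hlim i ⟨⟨ψ, hψ.continuous⟩, hψc⟩
      -- The hyperfilter refines `atTop`, so both sides of the integration by parts formula pass to
      -- the limit along it.
      have h3 := tendsto_nhds_unique h2 ((h1.mono_left Nat.hyperfilter_le_atTop).congr fun n ↦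
        (integral_gradient_mollify_mul (bumpSeq N n) hf hψ hψc i).symm)
      rw [eq_comm, neg_eq_iff_eq_neg]
      exact h3
  -- The bound on the vector length is recovered from the mollifications of `G`, which are the given
  -- gradients; the componentwise limits would not yield the sharp constant.
  refine ⟨G, hG, lintegral_rpow_le_of_mollify_le p hG.2.1 fun n ↦ ?_⟩
  refine le_of_eq_of_le (lintegral_congr fun x ↦ ?_) (hb n)
  rw [(hasGradientAt_mollify (bumpSeq N n) hG x).gradient]

end Existence

/-! ### Changing representatives and taking `p`-th roots -/

section Congr

variable {f f' : Eucl N → ℝ}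

theorem gagliardoEnergy_congr (s p : ℝ) (h : f =ᵐ[volume] f') :
    gagliardoEnergy s p f = gagliardoEnergy s p f' := by
  refine lintegral_congr_ae ?_
  filter_upwards [h] with y hy
  refine lintegral_congr_ae ?_
  filter_upwards [h] with x hx
  rw [hx, hy]

theorem HasWeakGradient.congr {g : Eucl N → Eucl N} (hfg : HasWeakGradient f g)
    (h : f =ᵐ[volume] f') : HasWeakGradient f' g := by
  refine ⟨hfg.1.congr h, hfg.2.1, fun φ hφ hφc i ↦ ?_⟩
  rw [← hfg.2.2 φ hφ hφc i]
  refine integral_congr_ae ?_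
  filter_upwards [h] with x hx
  rw [hx]

theorem scaledGagliardo_eq {p : ℝ} (hp : 0 < p) (f : Eucl N → ℝ) :
    scaledGagliardo p f =
      fun s ↦ (ENNReal.ofReal (1 - s) * gagliardoEnergy s p f) ^ (1 / p) := by
  ext s
  rw [ENNReal.mul_rpow_of_nonneg _ _ (by positivity)]
  rfl

theorem liminf_scaledGagliardo {p : ℝ} (hp : 0 < p) (f : Eucl N → ℝ) :
    liminf (scaledGagliardo p f) (𝓝[<] 1) =
      (liminf (fun s ↦ ENNReal.ofReal (1 - s) * gagliardoEnergy s p f) (𝓝[<] 1)) ^ (1 / p) := by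
  rw [scaledGagliardo_eq hp]
  exact ((ENNReal.orderIsoRpow (1 / p) (by positivity)).liminf_apply).symm

end Congr

/-! ### The two implications -/

section Main

variable {p : ℝ} {e : Eucl N} {f : Eucl N → ℝ}

/-- Finite lower limit of the rescaled seminorms implies Sobolev regularity. -/
theorem memH1p_of_liminf_lt_top (hN : 1 ≤ N) (hp : 1 < p) (he : ‖e‖ = 1)
    (hf : MemLp f (ENNReal.ofReal p) volume)
    (h : liminf (scaledGagliardo p f) (𝓝[<] (1 : ℝ)) < ⊤) : MemH1p p f := by
  have hp0 : 0 < p := by linarith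
  set f' := hf.1.mk f
  have hff' : f =ᵐ[volume] f' := hf.1.ae_eq_mk
  have hfm' : Measurable f' := hf.1.stronglyMeasurable_mk.measurable
  have hloc : LocallyIntegrable f' volume :=
    (hf.ae_eq hff').locallyIntegrable (by simpa using hp.le)
  rw [liminf_scaledGagliardo hp0] at h
  simp only [gagliardoEnergy_congr _ p hff'] at h
  set L := liminf (fun s ↦ ENNReal.ofReal (1 - s) * gagliardoEnergy s p f') (𝓝[<] 1) with hL
  have hLt : L ≠ ⊤ := fun hLt ↦ by
    rw [hLt, ENNReal.top_rpow_of_pos (by positivity)] at h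
    exact h.ne rfl
  have hc0 : ENNReal.ofReal (sphereConst p e) * ENNReal.ofReal (1 / p) ≠ 0 := by
    simpa using ⟨sphereConst_pos hp0 he, hp0⟩
  have hct : ENNReal.ofReal (sphereConst p e) * ENNReal.ofReal (1 / p) ≠ ⊤ :=
    ENNReal.mul_ne_top ENNReal.ofReal_ne_top ENNReal.ofReal_ne_top
  -- The bound `C` is the `C^1` lower bound solved for the gradient integral, with the energy of the
  -- mollification replaced by that of `f'`.
  obtain ⟨g, hg, hgb⟩ := exists_hasWeakGradient hp hloc
    (C := L / (ENNReal.ofReal (sphereConst p e) * ENNReal.ofReal (1 / p)))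
    (ENNReal.div_ne_top hLt hc0) fun n ↦ by
      rw [ENNReal.le_div_iff_mul_le (.inl hc0) (.inl hct), mul_comm, mul_right_comm]
      refine (le_liminf_gagliardoEnergy hN hp0 he (continuous_gradient_mollify (bumpSeq N n) hloc)
        (hasGradientAt_gradient_mollify (bumpSeq N n) hloc)).trans ?_
      refine liminf_le_liminf (.of_forall fun s ↦ ?_)
      gcongr
      exact gagliardoEnergy_mollify_le _ _ hp.le hloc hfm'
  refine ⟨hf, g, hg.congr hff'.symm, hg.2.1.aestronglyMeasurable, ?_⟩
  rw [eLpNorm_ofReal_eq hp0]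
  exact ENNReal.rpow_lt_top_of_nonneg (by positivity)
    (ne_top_of_le_ne_top (ENNReal.div_ne_top hLt hc0) hgb)

theorem exists_tendsto_scaledGagliardo (hN : 1 ≤ N) (hp : 1 < p) (he : ‖e‖ = 1)
    (hf : MemLp f (ENNReal.ofReal p) volume) {g : Eucl N → Eucl N} (hg : HasWeakGradient f g)
    (hgp : eLpNorm g (ENNReal.ofReal p) volume < ⊤) :
    ∃ L : ℝ≥0, Tendsto (scaledGagliardo p f) (𝓝[<] (1 : ℝ)) (𝓝 (L : ℝ≥0∞)) ∧
      eLpNorm g (ENNReal.ofReal p) volume =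
        ENNReal.ofReal ((p / sphereConst p e) ^ (1 / p)) * L := by
  have hp0 : 0 < p := by linarith
  have hK := sphereConst_pos hp0 he
  set f' := hf.1.mk f
  have hff' : f =ᵐ[volume] f' := hf.1.ae_eq_mk
  have hfm' : Measurable f' := hf.1.stronglyMeasurable_mk.measurable
  have hgI : ∫⁻ y, ‖g y‖ₑ ^ p < ⊤ := by
    rw [← eLpNorm_ofReal_rpow hp0]
    exact ENNReal.rpow_lt_top_of_nonneg hp0.le hgp.ne
  have h1 := tendsto_gagliardoEnergy hN hp.le he hfm' (hf.ae_eq hff') (hg.congr hff') hgI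
  have h2 := ((ENNReal.continuous_rpow_const (y := 1 / p)).tendsto _).comp h1
  set A := (ENNReal.ofReal (sphereConst p e) * (∫⁻ y, ‖g y‖ₑ ^ p) * ENNReal.ofReal (1 / p)) with hA
  have hAt : A ^ (1 / p) ≠ ⊤ := ENNReal.rpow_ne_top_of_nonneg (by positivity)
    (ENNReal.mul_ne_top (ENNReal.mul_ne_top ENNReal.ofReal_ne_top hgI.ne) ENNReal.ofReal_ne_top)
  refine ⟨(A ^ (1 / p)).toNNReal, ?_, ?_⟩
  · rw [ENNReal.coe_toNNReal hAt, scaledGagliardo_eq hp0]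
    simp only [gagliardoEnergy_congr _ p hff']
    exact h2
  · rw [ENNReal.coe_toNNReal hAt, eLpNorm_ofReal_eq hp0,
      ← ENNReal.ofReal_rpow_of_pos (by positivity), ← ENNReal.mul_rpow_of_nonneg _ _ (by positivity)]
    congr 1
    rw [hA, mul_right_comm, ← mul_assoc, ← ENNReal.ofReal_mul hK.le,
      ← ENNReal.ofReal_mul (by positivity)]
    have : p / sphereConst p e * (sphereConst p e * (1 / p)) = 1 := by
      field_simp
    rw [this, ENNReal.ofReal_one, one_mul]

end Main

end BBM

theorem mainTheorem6 (N : ℕ) (hN : 1 ≤ N) (p : ℝ) (hp : 1 < p)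
    (e : BBM.Eucl N) (he : ‖e‖ = 1)
    (f : BBM.Eucl N → ℝ) (hf : MemLp f (ENNReal.ofReal p) volume) :
    (BBM.gradLpNorm p f < ⊤ ↔
      ∃ L : ℝ≥0, Tendsto (BBM.scaledGagliardo p f) (𝓝[<] (1 : ℝ)) (𝓝 (L : ℝ≥0∞))) ∧
    (∀ L : ℝ≥0, Tendsto (BBM.scaledGagliardo p f) (𝓝[<] (1 : ℝ)) (𝓝 (L : ℝ≥0∞)) →
      BBM.gradLpNorm p f =
        ENNReal.ofReal ((p / BBM.sphereConst p e) ^ (1 / p)) * (L : ℝ≥0∞)) ∧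
    (liminf (BBM.scaledGagliardo p f) (𝓝[<] (1 : ℝ)) < ⊤ → BBM.MemH1p p f) := by
  have hmem := BBM.memH1p_of_liminf_lt_top hN hp he hf
  have hval : ∀ L : ℝ≥0, Tendsto (BBM.scaledGagliardo p f) (𝓝[<] (1 : ℝ)) (𝓝 (L : ℝ≥0∞)) →
      BBM.gradLpNorm p f =
        ENNReal.ofReal ((p / BBM.sphereConst p e) ^ (1 / p)) * (L : ℝ≥0∞) := by
    intro L hL
    -- Every weak gradient of finite norm has the norm dictated by the limit. This evaluates the
    -- infimum without invoking uniqueness of weak gradients; `hmem` supplies one such gradient.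
    have hev (g : BBM.Eucl N → BBM.Eucl N) (hg : BBM.HasWeakGradient f g)
        (hgt : eLpNorm g (ENNReal.ofReal p) volume < ⊤) : eLpNorm g (ENNReal.ofReal p) volume =
        ENNReal.ofReal ((p / BBM.sphereConst p e) ^ (1 / p)) * (L : ℝ≥0∞) := by
      obtain ⟨L', hL', hgL'⟩ := BBM.exists_tendsto_scaledGagliardo hN hp he hf hg hgt
      rw [hgL', tendsto_nhds_unique hL hL']
    obtain ⟨-, g, hg, hgp⟩ := hmem (by rw [hL.liminf_eq]; exact ENNReal.coe_lt_top)
    refine le_antisymm ((iInf₂_le g hg).trans (hev g hg hgp.2).le) (le_iInf₂ fun g' hg' ↦ ?_)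
    rcases eq_or_ne (eLpNorm g' (ENNReal.ofReal p) volume) ⊤ with h | h
    · rw [h]; exact le_top
    · exact (hev g' hg' h.lt_top).ge
  refine ⟨⟨fun h ↦ ?_, fun ⟨L, hL⟩ ↦ ?_⟩, hval, hmem⟩
  · simp only [BBM.gradLpNorm, iInf_lt_iff] at h
    obtain ⟨g, hg, hgt⟩ := h
    obtain ⟨L, hL, -⟩ := BBM.exists_tendsto_scaledGagliardo hN hp he hf hg hgt
    exact ⟨L, hL⟩
  · rw [hval L hL]
    exact ENNReal.mul_lt_top ENNReal.ofReal_lt_top ENNReal.coe_lt_top
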